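/- Let $\mathcal K=\{\{1,2\},\{1,4\},\{2,3\},\{3,4\}\}$, and consider collections $\boldsymbol\beta=\bigl((\beta_{i,j})_{\{i,j\}\in\mathcal K},(\beta_i)_{i=1,\dots,4}\bigr)$ of real-valued functions $\beta_{i,j}(x_i,x_j)$ and $\beta_i(x_i)$ of binary variables $x_1,\dots,x_4\in\{0,1\}$. Define the following sets of such collections. - $\mathcal{LM}(\mathcal K)$, the local marginal polytope: all $\boldsymbol\beta$ with $0\le\beta_{i,j}(x_i,x_j)\le 1$, $\sum_{x_j}\beta_{i,j}(x_i,x_j)=\beta_i(x_i)$, $\sum_{x_i}\beta_{i,j}(x_i,x_j)=\beta_j(x_j)$ and $\sum_{x_i}\beta_i(x_i)=1$ for all $\{i,j\}\in\mathcal K$, all $i$, and all values of the variables. - $\mathcal M(\mathsf N_{\mathrm S})$, $\mathcal M(\mathsf N_{\mathrm{cyc}})$, $\mathcal M(\mathsf N_{\mathrm{Mkov}})$: all $\boldsymbol\beta$ whose entries are the pairwise marginals (for the pairs in $\mathcal K$) and the single-variable marginals of a probability mass function $p=g/Z$ on $\{0,1\}^4$, where $Z=\sum_{\boldsymbol x}g(\boldsymbol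 x)\neq 0$ and $g$ is, respectively, an arbitrary function $f(x_1,x_2,x_3,x_4)$; a product $f_{1,2}(x_1,x_2)f_{1,4}(x_1,x_4)f_{3,2}(x_3,x_2)f_{3,4}(x_3,x_4)$; a product $f_{1,4}(x_1,x_4)f_{1,2}(x_1,x_2)f_{3,2}(x_3,x_2)$ (the Markov chain $X_4-X_1-X_2-X_3$), with arbitrary non-negative real factors. - $\mathcal M(\mathsf N_{\mathrm Q})$: all $\boldsymbol\beta$ for which there are a positive semidefinite matrix $\rho\in\mathbb C^{4\times 4}$ of trace $1$, with rows indexed by $(x_1,x_2)$ and columns by $(x_1',x_2')$, and unitary matrices $U_1,U_2\in\mathbb C^{2\times 2}$ such that, with $$q(\boldsymbol x,\boldsymbol x')=\rho\bigl((x_1,x_2),(x_1',x_2')\bigr)\,U_1(x_3,x_1)\overline{U_1(x_3',x_1')}\,U_2(x_4,x_2)\overline{U_2(x_4',x_2')}\,[x_3=x_3']\,[x_4=x_4'],$$ the value $\beta_{i,j}(a,b)$ is, for every $\{i,j\}\in\mathcal K$, the sum of $q(\boldsymbol x,\boldsymbol x')$ over all $(\boldsymbol x,\boldsymbol x')$ with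 $x_i=x_i'=a$ and $x_j=x_j'=b$, and $\beta_i(a)$ is, for every $i$, the sum of $q(\boldsymbol x,\boldsymbol x')$ over all $(\boldsymbol x,\boldsymbol x')$ with $x_i=x_i'=a$. Then $$\mathcal M(\mathsf N_{\mathrm{Mkov}})\subsetneq\mathcal M(\mathsf N_{\mathrm{cyc}})\subsetneq\mathcal M(\mathsf N_{\mathrm S})\subsetneq\mathcal{LM}(\mathcal K),\qquad \mathcal M(\mathsf N_{\mathrm Q})\subsetneq\mathcal{LM}(\mathcal K),$$ and each of the following eight sets, into which these sets divide $\mathcal{LM}(\mathcal K)$, is non-empty: 1. $\mathcal M(\mathsf N_{\mathrm{Mkov}})\cap\mathcal M(\mathsf N_{\mathrm Q})$; 2. $\mathcal M(\mathsf N_{\mathrm{Mkov}})\setminus\mathcal M(\mathsf N_{\mathrm Q})$; 3. $(\mathcal M(\mathsf N_{\mathrm{cyc}})\cap\mathcal M(\mathsf N_{\mathrm Q}))\setminus\mathcal M(\mathsf N_{\mathrm{Mkov}})$; 4. $\mathcal M(\mathsf N_{\mathrm{cyc}})\setminus(\mathcal M(\mathsf N_{\mathrm{Mkov}})\cup\mathcal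 M(\mathsf N_{\mathrm Q}))$; 5. $(\mathcal M(\mathsf N_{\mathrm S})\cap\mathcal M(\mathsf N_{\mathrm Q}))\setminus\mathcal M(\mathsf N_{\mathrm{cyc}})$; 6. $\mathcal M(\mathsf N_{\mathrm S})\setminus(\mathcal M(\mathsf N_{\mathrm{cyc}})\cup\mathcal M(\mathsf N_{\mathrm Q}))$; 7. $\mathcal M(\mathsf N_{\mathrm Q})\setminus\mathcal M(\mathsf N_{\mathrm S})$; 8. $\mathcal{LM}(\mathcal K)\setminus(\mathcal M(\mathsf N_{\mathrm S})\cup\mathcal M(\mathsf N_{\mathrm Q}))$. -/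

import Mathlib

open scoped NNReal ComplexOrder

namespace TwoQubitMarginals

/-- The labels of the four variables `x₁, x₂, x₃, x₄`. -/
inductive Var
  | x1 | x2 | x3 | x4
  deriving DecidableEq

instance : Fintype Var := ⟨{.x1, .x2, .x3, .x4}, fun x => by cases x <;> decide⟩

/-- The alphabet `{0, 1}` of every variable. -/
abbrev Bit := Fin 2

/-- The collection `K = {{1,2}, {1,4}, {2,3}, {3,4}}`. Each pair is listed in the order in which
its variables are the row and the column index of the matrix `β_{i,j}`: first a variable of
`{x₁, x₃}`, then one of `{x₂, x₄}`. -/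
abbrev K : Finset (Var × Var) :=
  {(.x1, .x2), (.x1, .x4), (.x3, .x2), (.x3, .x4)}

/-- A collection `β = ((β_{i,j})_{{i,j} ∈ K}, (β_i)_i)`. The diagonal `2 × 2` matrix `β_i` is
recorded by its diagonal, the function `x_i ↦ β_i(x_i)`. -/
@[ext]
structure Beliefs where
  pair : K → Matrix Bit Bit ℝ
  single : Var → Bit → ℝ

section Marginals

variable {A M : Type} [Fintype A] [DecidableEq A] [AddCommMonoid M]

/-- The marginal of `p` for the variables `i` and `j`, at the values `x i = a`, `x j = b`:
the sum of `p` over all the other variables. -/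
def pairMarginal (p : (Var → A) → M) (i j : Var) (a b : A) : M :=
  ∑ x : Var → A with x i = a ∧ x j = b, p x

/-- The marginal of `p` for the variable `i`, at the value `x i = a`. -/
def singleMarginal (p : (Var → A) → M) (i : Var) (a : A) : M :=
  ∑ x : Var → A with x i = a, p x

end Marginals

/-! ### Standard normal factor graphs in the variables `x₁, …, x₄` -/

/-- The graph of a normal factor graph whose edges are the four variables: `boundary f` is the set
`∂f` of the edges incident on the function node `f`, and each edge is incident on one function node
(half edge) or on two (full edge). -/
structure NormalGraph where
  Node : Type
  [fintypeNode : Fintype Node]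
  boundary : Node → Finset Var
  normal : ∀ e : Var,
    1 ≤ (Finset.univ.filter fun f => e ∈ boundary f).card ∧
      (Finset.univ.filter fun f => e ∈ boundary f).card ≤ 2

attribute [instance] NormalGraph.fintypeNode

namespace NormalGraph

/-- A choice of the local functions: each node `f` carries an arbitrary non-negative function of
the variables on its incident edges. -/
abbrev LocalFunctions (G : NormalGraph) : Type :=
  (f : G.Node) → ((G.boundary f → Bit) → ℝ≥0)

/-- The global function, the product of the local functions. -/
noncomputable def globalFunction (G : NormalGraph) (F : G.LocalFunctions) (x : Var → Bit) : ℝ :=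
  ∏ f : G.Node, (F f (fun e => x e) : ℝ)

/-- The partition function. -/
noncomputable def partitionFunction (G : NormalGraph) (F : G.LocalFunctions) : ℝ :=
  ∑ x : Var → Bit, G.globalFunction F x

/-- The induced probability mass function (meaningful when the partition function is non-zero). -/
noncomputable def pmf (G : NormalGraph) (F : G.LocalFunctions) (x : Var → Bit) : ℝ :=
  G.globalFunction F x / G.partitionFunction F

/-- The set of realizable marginals of a standard normal factor graph: all `β` that are given by
the marginals of the induced probability mass function, for some choice of the local functions for
which this mass function exists. -/
def realizableMarginals (G : NormalGraph) : Set Beliefs :=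
  {β | ∃ F : G.LocalFunctions, G.partitionFunction F ≠ 0 ∧
    (∀ (e : K) (a b : Bit), β.pair e a b = pairMarginal (G.pmf F) e.1.1 e.1.2 a b) ∧
    ∀ (i : Var) (a : Bit), β.single i a = singleMarginal (G.pmf F) i a}

end NormalGraph

/-- The four-cycle: nodes `f_{1,2}, f_{1,4}, f_{3,2}, f_{3,4}`, with `f_{i,j}` incident on the
(full) edges `x_i` and `x_j`. -/
def fourCycle : NormalGraph where
  Node := K
  boundary f := {f.1.1, f.1.2}
  normal := by decide

/-- The Markov chain `X₄ - X₁ - X₂ - X₃`: three nodes incident on `{x₁, x₄}`, `{x₁, x₂}` and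
`{x₃, x₂}`; `x₃` and `x₄` are half edges. -/
def markovChain : NormalGraph where
  Node := ({(.x1, .x4), (.x1, .x2), (.x3, .x2)} : Finset (Var × Var))
  boundary f := {f.1.1, f.1.2}
  normal := by decide

/-- A single node `f` with the four half edges `x₁, x₂, x₃, x₄`. -/
def singleNode : NormalGraph where
  Node := Unit
  boundary _ := Finset.univ
  normal := by decide

/-- The local marginal polytope. -/
def localMarginalPolytope : Set Beliefs :=
  {β | (∀ (e : K) (a b : Bit), 0 ≤ β.pair e a b ∧ β.pair e a b ≤ 1) ∧
    (∀ (e : K) (a : Bit), ∑ b, β.pair e a b = β.single e.1.1 a) ∧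
    (∀ (e : K) (b : Bit), ∑ a, β.pair e a b = β.single e.1.2 b) ∧
    ∀ i : Var, ∑ a, β.single i a = 1}

/-! ### The two-qubit system -/

/-- The global function of the two-qubit factor graph, a simple quantum mass function in the paired
variables `x̃ᵢ = (xᵢ, xᵢ')`. The state `ρ` has row index `(x₁, x₂)` and column index `(x₁', x₂')`;
`U₁` maps the first qubit from `x₁` to `x₃`, `U₂` the second one from `x₂` to `x₄`; identity
matrices join `x₃` to `x₃'` and `x₄` to `x₄'`. -/
noncomputable def quantumMassFunction (ρ : Matrix (Bit × Bit) (Bit × Bit) ℂ)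
    (U₁ U₂ : Matrix Bit Bit ℂ) (x : Var → Bit × Bit) : ℂ :=
  ρ ((x .x1).1, (x .x2).1) ((x .x1).2, (x .x2).2) *
    (U₁ (x .x3).1 (x .x1).1 * U₁.conjTranspose (x .x1).2 (x .x3).2) *
    (U₂ (x .x4).1 (x .x2).1 * U₂.conjTranspose (x .x2).2 (x .x4).2) *
    ((1 : Matrix Bit Bit ℂ) (x .x3).1 (x .x3).2 * (1 : Matrix Bit Bit ℂ) (x .x4).1 (x .x4).2)

/-- The set of marginals of the classicable variables of the two-qubit system: all `β` for which
there are a density matrix `ρ` and unitary matrices `U₁`, `U₂` such that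
`β_{i,j}(a, b) = q_{i,j}((a, a), (b, b))` and `β_i(a) = q_i((a, a))`. -/
def quantumMarginals : Set Beliefs :=
  {β | ∃ (ρ : Matrix (Bit × Bit) (Bit × Bit) ℂ) (U₁ U₂ : Matrix Bit Bit ℂ),
    ρ.PosSemidef ∧ ρ.trace = 1 ∧
    U₁ ∈ Matrix.unitaryGroup Bit ℂ ∧ U₂ ∈ Matrix.unitaryGroup Bit ℂ ∧
    (∀ (e : K) (a b : Bit), (β.pair e a b : ℂ) =
      pairMarginal (quantumMassFunction ρ U₁ U₂) e.1.1 e.1.2 (a, a) (b, b)) ∧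
    ∀ (i : Var) (a : Bit), (β.single i a : ℂ) =
      singleMarginal (quantumMassFunction ρ U₁ U₂) i (a, a)}

end TwoQubitMarginals

open TwoQubitMarginals

/-!
The classical sets are compared through two properties of factorizations. First, a factor of a
product function cannot vanish where the corresponding pairwise marginal does not, so the support
of a Markov chain or of a four-cycle contains every assignment all of whose factors are seen to be
non-zero by the marginals (`notMem_markovChain`, `notMem_fourCycle`). Second, every assignment
violates at least one of `x₁ = x₂`, `x₁ = x₄`, `x₃ = x₂`, `x₃ ≠ x₄`, which is the CHSH inequality
for the marginals of any probability mass function (`one_le_chshSum`). If it is tight, the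
assignments violating three of these relations have probability zero. Marginals for which it is
tight and for which such an assignment is compatible with all the pairwise marginals are thus not
realizable on the four-cycle.

A quantum collection consists of the outcome probabilities of two local measurements on each
qubit, in the standard basis and in the basis given by a unitary matrix
(`mem_quantumMarginals_iff`). These probabilities are non-negative because the state is positive
semidefinite, and consistent because the matrices are unitary. The only obstruction needed is that
the measurements are projective of rank one: if `x₁ = x₂` almost surely, then `x₄` arises from
`x₁` through the channel `|U₂(x₄, x₁)|²`, which is doubly stochastic
(`pair_e14_of_pair_e12_eq_zero`). All the points outside the quantum set considered below have
`x₁ = x₂` and violate this symmetry.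

Conversely, all the quantum points used here have uniform single-variable marginals and arise from
states `(I + t₁₂ Z ⊗ Z + t₁₄ Z ⊗ X + t₃₂ X ⊗ Z + t₃₄ X ⊗ X + s Y ⊗ Y) / 4`, with measurements of
the Pauli matrices `Z` and `X` (`corrBeliefs_mem_quantumMarginals`). With correlations
`(α, α, α, -α)` such a state exists for `0 ≤ α ≤ √2 / 2`, and `α = 0`, `1 / 2`, `2 / 3` give the uniform
collection, a collection on the CHSH facet, and a violation of the CHSH inequality.
-/

namespace TwoQubitMarginals

/-! ### Marginals as explicit sums -/

/-- The assignment of the values `a`, `b`, `c`, `d` to the variables `x₁`, `x₂`, `x₃`, `x₄`. -/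
def assign {A : Type*} (a b c d : A) : Var → A
  | .x1 => a
  | .x2 => b
  | .x3 => c
  | .x4 => d

section Assign

variable {A : Type*} (a b c d : A)

@[simp] theorem assign_x1 : assign a b c d .x1 = a := rfl
@[simp] theorem assign_x2 : assign a b c d .x2 = b := rfl
@[simp] theorem assign_x3 : assign a b c d .x3 = c := rfl
@[simp] theorem assign_x4 : assign a b c d .x4 = d := rfl

end Assign

/-- An assignment is the tuple of its four values. -/
def assignEquiv (A : Type*) : A × A × A × A ≃ (Var → A) where
  toFun t := assign t.1 t.2.1 t.2.2.1 t.2.2.2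
  invFun x := (x .x1, x .x2, x .x3, x .x4)
  left_inv _ := rfl
  right_inv x := by ext v; cases v <;> rfl

section Sums

variable {A M : Type} [Fintype A] [AddCommMonoid M]

theorem sum_assign (p : (Var → A) → M) :
    ∑ x, p x = ∑ a, ∑ b, ∑ c, ∑ d, p (assign a b c d) := by
  rw [← (assignEquiv A).sum_comp]
  simp only [Fintype.sum_prod_type]
  rfl

variable [DecidableEq A] (p : (Var → A) → M)

theorem pairMarginal_x1_x2 (a b : A) :
    pairMarginal p .x1 .x2 a b = ∑ c, ∑ d, p (assign a b c d) := by
  rw [pairMarginal, Finset.sum_filter, sum_assign]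
  change (∑ a', ∑ b', ∑ c', ∑ d', if a' = a ∧ b' = b then p (assign a' b' c' d') else 0) = _
  simp [ite_and, Finset.sum_ite_irrel]

theorem pairMarginal_x1_x4 (a d : A) :
    pairMarginal p .x1 .x4 a d = ∑ b, ∑ c, p (assign a b c d) := by
  rw [pairMarginal, Finset.sum_filter, sum_assign]
  change (∑ a', ∑ b', ∑ c', ∑ d', if a' = a ∧ d' = d then p (assign a' b' c' d') else 0) = _
  simp [ite_and, Finset.sum_ite_irrel]

theorem pairMarginal_x3_x2 (c b : A) :
    pairMarginal p .x3 .x2 c b = ∑ a, ∑ d, p (assign a b c d) := by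
  rw [pairMarginal, Finset.sum_filter, sum_assign]
  change (∑ a', ∑ b', ∑ c', ∑ d', if c' = c ∧ b' = b then p (assign a' b' c' d') else 0) = _
  simp [ite_and, Finset.sum_ite_irrel]

theorem pairMarginal_x3_x4 (c d : A) :
    pairMarginal p .x3 .x4 c d = ∑ a, ∑ b, p (assign a b c d) := by
  rw [pairMarginal, Finset.sum_filter, sum_assign]
  change (∑ a', ∑ b', ∑ c', ∑ d', if c' = c ∧ d' = d then p (assign a' b' c' d') else 0) = _
  simp [ite_and, Finset.sum_ite_irrel]

theorem sum_pairMarginal_right (i j : Var) (a : A) :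
    ∑ b, pairMarginal p i j a b = singleMarginal p i a := by
  simp only [pairMarginal, singleMarginal, Finset.sum_filter]
  rw [Finset.sum_comm]
  simp [ite_and]

theorem sum_pairMarginal_left (i j : Var) (b : A) :
    ∑ a, pairMarginal p i j a b = singleMarginal p j b := by
  simp only [pairMarginal, singleMarginal, Finset.sum_filter]
  rw [Finset.sum_comm]
  refine Finset.sum_congr rfl fun x _ => ?_
  simp [ite_and]

theorem sum_singleMarginal (i : Var) : ∑ a, singleMarginal p i a = ∑ x, p x := by
  simp only [singleMarginal, Finset.sum_filter]
  rw [Finset.sum_comm]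
  simp

end Sums

/-! ### The pairs of `K` -/

/-- The pair `{1, 2}` as an element of `K`. -/
abbrev e12 : K := ⟨(.x1, .x2), by decide⟩
/-- The pair `{1, 4}` as an element of `K`. -/
abbrev e14 : K := ⟨(.x1, .x4), by decide⟩
/-- The pair `{3, 2}` as an element of `K`. -/
abbrev e32 : K := ⟨(.x3, .x2), by decide⟩
/-- The pair `{3, 4}` as an element of `K`. -/
abbrev e34 : K := ⟨(.x3, .x4), by decide⟩

theorem forall_K {P : K → Prop} : (∀ e, P e) ↔ P e12 ∧ P e14 ∧ P e32 ∧ P e34 := by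
  refine ⟨fun h => ⟨h _, h _, h _, h _⟩, ?_⟩
  rintro ⟨h1, h2, h3, h4⟩ ⟨e, he⟩
  have := he
  simp only [K, Finset.mem_insert, Finset.mem_singleton] at this
  rcases this with rfl | rfl | rfl | rfl <;> assumption

/-- The function on `K` with the given values at `{1, 2}`, `{1, 4}`, `{3, 2}` and `{3, 4}`. -/
def onPairs {α : Type*} (r12 r14 r32 r34 : α) (e : K) : α :=
  if e = e12 then r12 else if e = e14 then r14 else if e = e32 then r32 else r34

section OnPairs

variable {α : Type*} (r12 r14 r32 r34 : α)

@[simp] theorem onPairs_e12 : onPairs r12 r14 r32 r34 e12 = r12 := rfl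
@[simp] theorem onPairs_e14 : onPairs r12 r14 r32 r34 e14 = r14 := rfl
@[simp] theorem onPairs_e32 : onPairs r12 r14 r32 r34 e32 = r32 := rfl
@[simp] theorem onPairs_e34 : onPairs r12 r14 r32 r34 e34 = r34 := rfl

end OnPairs

theorem univ_K : (Finset.univ : Finset K) = {e12, e14, e32, e34} := by decide

/-! ### Realizable marginals of classical factor graphs -/

/-- The collection of the marginals of a real function on the assignments. -/
def marginals (p : (Var → Bit) → ℝ) : Beliefs where
  pair e a b := pairMarginal p e.1.1 e.1.2 a b
  single i a := singleMarginal p i a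

/-- The collection of the marginals of `g / Z`, where `Z` is the sum of all values of `g`. -/
noncomputable def normalizedMarginals (g : (Var → Bit) → ℝ) : Beliefs :=
  marginals fun x => g x / ∑ y, g y

theorem NormalGraph.mem_realizableMarginals_iff (G : NormalGraph) (β : Beliefs) :
    β ∈ G.realizableMarginals ↔ ∃ F : G.LocalFunctions, ∑ x, G.globalFunction F x ≠ 0 ∧
      β = normalizedMarginals (G.globalFunction F) := by
  refine exists_congr fun F => and_congr_right fun _ => ⟨fun ⟨h1, h2⟩ => ?_, ?_⟩
  · ext e a b
    exacts [h1 e a b, h2 e a]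
  · rintro rfl
    exact ⟨fun _ _ _ => rfl, fun _ _ => rfl⟩

theorem mem_singleNode_iff (β : Beliefs) :
    β ∈ singleNode.realizableMarginals ↔
      ∃ g : (Var → Bit) → ℝ, (∀ x, 0 ≤ g x) ∧ ∑ x, g x ≠ 0 ∧ β = normalizedMarginals g := by
  rw [NormalGraph.mem_realizableMarginals_iff]
  constructor
  · rintro ⟨F, hZ, rfl⟩
    exact ⟨singleNode.globalFunction F, fun x => Finset.prod_nonneg fun _ _ => NNReal.coe_nonneg _,
      hZ, rfl⟩
  · rintro ⟨g, hg, hZ, rfl⟩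
    let F : singleNode.LocalFunctions := fun _ y => ⟨g fun v => y ⟨v, Finset.mem_univ v⟩, hg _⟩
    have hF : singleNode.globalFunction F = g := by
      ext x
      change ∏ _ : Unit, g x = g x
      simp
    exact ⟨F, by rwa [hF], by rw [hF]⟩

/-- If each node is incident on the two edges `ends f`, then the global functions are the products
of functions of two variables. -/
theorem NormalGraph.mem_realizableMarginals_iff_of_ends (G : NormalGraph)
    (ends : G.Node → Var × Var) (hG : ∀ f, G.boundary f = {(ends f).1, (ends f).2})
    (β : Beliefs) :
    β ∈ G.realizableMarginals ↔ ∃ φ : G.Node → Bit → Bit → ℝ≥0,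
      ∑ x : Var → Bit, ∏ f, (φ f (x (ends f).1) (x (ends f).2) : ℝ) ≠ 0 ∧
        β = normalizedMarginals fun x => ∏ f, (φ f (x (ends f).1) (x (ends f).2) : ℝ) := by
  rw [NormalGraph.mem_realizableMarginals_iff]
  constructor
  · rintro ⟨F, hZ, rfl⟩
    let φ (f : G.Node) (a b : Bit) : ℝ≥0 := F f fun v => if v.1 = (ends f).1 then a else b
    have hφ : G.globalFunction F =
        fun x => ∏ f, (φ f (x (ends f).1) (x (ends f).2) : ℝ) := by
      ext x
      refine Finset.prod_congr rfl fun f _ => congrArg _ (congrArg (F f) (funext fun v => ?_))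
      have hv : v.1 ∈ ({(ends f).1, (ends f).2} : Finset Var) := hG f ▸ v.2
      rw [Finset.mem_insert, Finset.mem_singleton] at hv
      change x v = if v.1 = (ends f).1 then x (ends f).1 else x (ends f).2
      split_ifs with h
      · rw [h]
      · rw [hv.resolve_left h]
    exact ⟨φ, by rwa [hφ] at hZ, by rw [hφ]⟩
  · rintro ⟨φ, hZ, rfl⟩
    let F : G.LocalFunctions := fun f y =>
      φ f (y ⟨(ends f).1, by simp [hG]⟩) (y ⟨(ends f).2, by simp [hG]⟩)
    exact ⟨F, hZ, rfl⟩

/-- The product function of the four-cycle. The Markov chain is the case `f34 = 1`. -/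
def cycleProduct (f12 f14 f32 f34 : Bit → Bit → ℝ≥0) (x : Var → Bit) : ℝ :=
  f12 (x .x1) (x .x2) * f14 (x .x1) (x .x4) * f32 (x .x3) (x .x2) * f34 (x .x3) (x .x4)

theorem mem_fourCycle_iff (β : Beliefs) :
    β ∈ fourCycle.realizableMarginals ↔
      ∃ f12 f14 f32 f34, ∑ x, cycleProduct f12 f14 f32 f34 x ≠ 0 ∧
        β = normalizedMarginals (cycleProduct f12 f14 f32 f34) := by
  rw [fourCycle.mem_realizableMarginals_iff_of_ends (fun f : K => f.1) fun _ => rfl]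
  have key (φ : K → Bit → Bit → ℝ≥0) :
      (fun x : Var → Bit => ∏ e : fourCycle.Node, (φ e (x e.1.1) (x e.1.2) : ℝ)) =
        cycleProduct (φ e12) (φ e14) (φ e32) (φ e34) := by
    ext x
    change ∏ e : K, (φ e (x e.1.1) (x e.1.2) : ℝ) = _
    rw [univ_K]
    simp [cycleProduct, mul_assoc]
  constructor
  · rintro ⟨φ, hZ, rfl⟩
    refine ⟨φ e12, φ e14, φ e32, φ e34, ?_⟩
    rw [← key φ]
    exact ⟨hZ, rfl⟩
  · rintro ⟨f12, f14, f32, f34, hZ, rfl⟩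
    let φ : K → Bit → Bit → ℝ≥0 := onPairs f12 f14 f32 f34
    have h : cycleProduct f12 f14 f32 f34 =
      cycleProduct (φ e12) (φ e14) (φ e32) (φ e34) := rfl
    rw [h, ← key φ] at hZ
    exact ⟨φ, hZ, by rw [h, ← key φ]⟩

theorem mem_markovChain_iff (β : Beliefs) :
    β ∈ markovChain.realizableMarginals ↔
      ∃ f12 f14 f32, ∑ x, cycleProduct f12 f14 f32 1 x ≠ 0 ∧
        β = normalizedMarginals (cycleProduct f12 f14 f32 1) := by
  let N : Finset (Var × Var) := {(.x1, .x4), (.x1, .x2), (.x3, .x2)}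
  let n14 : N := ⟨(.x1, .x4), by decide⟩
  let n12 : N := ⟨(.x1, .x2), by decide⟩
  let n32 : N := ⟨(.x3, .x2), by decide⟩
  have univ_N : (Finset.univ : Finset N) = {n14, n12, n32} := by decide
  have h1 : n14 ∉ ({n12, n32} : Finset N) := by decide
  have h2 : n12 ∉ ({n32} : Finset N) := by decide
  rw [markovChain.mem_realizableMarginals_iff_of_ends (fun f : N => f.1) fun _ => rfl]
  have key (φ : N → Bit → Bit → ℝ≥0) :
      (fun x : Var → Bit => ∏ e : markovChain.Node, (φ e (x e.1.1) (x e.1.2) : ℝ)) =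
        cycleProduct (φ n12) (φ n14) (φ n32) 1 := by
    ext x
    change ∏ e : N, (φ e (x e.1.1) (x e.1.2) : ℝ) = _
    rw [univ_N, Finset.prod_insert h1, Finset.prod_insert h2, Finset.prod_singleton]
    simp only [cycleProduct, Pi.one_apply, NNReal.coe_one, n12, n14, n32]
    ring
  constructor
  · rintro ⟨φ, hZ, rfl⟩
    refine ⟨φ n12, φ n14, φ n32, ?_⟩
    rw [← key φ]
    exact ⟨hZ, rfl⟩
  · rintro ⟨f12, f14, f32, hZ, rfl⟩
    let φ (e : N) : Bit → Bit → ℝ≥0 :=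
      if e = n12 then f12 else if e = n14 then f14 else f32
    have h : cycleProduct f12 f14 f32 1 = cycleProduct (φ n12) (φ n14) (φ n32) 1 := rfl
    rw [h, ← key φ] at hZ
    exact ⟨φ, hZ, by rw [h, ← key φ]⟩

/-! ### The inclusions between the classical sets -/

theorem cycleProduct_nonneg (f12 f14 f32 f34 : Bit → Bit → ℝ≥0) (x : Var → Bit) :
    0 ≤ cycleProduct f12 f14 f32 f34 x := by
  unfold cycleProduct
  positivity

theorem markovChain_subset_fourCycle :
    markovChain.realizableMarginals ⊆ fourCycle.realizableMarginals := by
  intro β h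
  obtain ⟨f12, f14, f32, h⟩ := (mem_markovChain_iff β).1 h
  exact (mem_fourCycle_iff β).2 ⟨f12, f14, f32, 1, h⟩

theorem fourCycle_subset_singleNode :
    fourCycle.realizableMarginals ⊆ singleNode.realizableMarginals := by
  intro β h
  obtain ⟨f12, f14, f32, f34, h⟩ := (mem_fourCycle_iff β).1 h
  exact (mem_singleNode_iff β).2 ⟨_, cycleProduct_nonneg f12 f14 f32 f34, h⟩

/-- Marginals which are non-negative, consistent and normalized are in the local marginal polytope:
the upper bound on the pairwise marginals is automatic. -/
theorem mem_localMarginalPolytope_of_nonneg {β : Beliefs} (h0 : ∀ e a b, 0 ≤ β.pair e a b)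
    (h1 : ∀ (e : K) (a : Bit), ∑ b, β.pair e a b = β.single e.1.1 a)
    (h2 : ∀ (e : K) (b : Bit), ∑ a, β.pair e a b = β.single e.1.2 b)
    (h3 : ∀ i : Var, ∑ a, β.single i a = 1) : β ∈ localMarginalPolytope := by
  refine ⟨fun e a b => ⟨h0 e a b, ?_⟩, h1, h2, h3⟩
  calc β.pair e a b ≤ ∑ b, β.pair e a b :=
        Finset.single_le_sum (fun b _ => h0 e a b) (Finset.mem_univ b)
    _ = β.single e.1.1 a := h1 e a
    _ ≤ ∑ a, β.single e.1.1 a :=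
        Finset.single_le_sum (fun a _ => (h1 e a).symm ▸ Finset.sum_nonneg fun b _ => h0 e a b)
          (Finset.mem_univ a)
    _ = 1 := h3 _

theorem singleNode_subset_localMarginalPolytope :
    singleNode.realizableMarginals ⊆ localMarginalPolytope := by
  intro β h
  obtain ⟨g, hg, hZ, rfl⟩ := (mem_singleNode_iff β).1 h
  refine mem_localMarginalPolytope_of_nonneg (fun e a b => ?_)
    (fun e a => sum_pairMarginal_right _ _ _ a) (fun e b => sum_pairMarginal_left _ _ _ b)
    fun i => (sum_singleMarginal _ i).trans ?_
  · change 0 ≤ ∑ x : Var → Bit with _, _ / _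
    exact Finset.sum_nonneg fun x _ => div_nonneg (hg x) (Finset.sum_nonneg fun x _ => hg x)
  · rw [← Finset.sum_div, div_self hZ]

/-! ### Obstructions to classical realizability -/

/-- The left-hand side `P(x₁ ≠ x₂) + P(x₁ ≠ x₄) + P(x₃ ≠ x₂) + P(x₃ = x₄) ≥ 1` of the CHSH
inequality. -/
def chshSum (β : Beliefs) : ℝ :=
  β.pair e12 0 1 + β.pair e12 1 0 + (β.pair e14 0 1 + β.pair e14 1 0) +
    (β.pair e32 0 1 + β.pair e32 1 0) + (β.pair e34 0 0 + β.pair e34 1 1)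

theorem normalizedMarginals_pair_e12 (g : (Var → Bit) → ℝ) (a b : Bit) :
    (normalizedMarginals g).pair e12 a b = ∑ c, ∑ d, g (assign a b c d) / ∑ y, g y :=
  pairMarginal_x1_x2 _ a b

theorem normalizedMarginals_pair_e14 (g : (Var → Bit) → ℝ) (a d : Bit) :
    (normalizedMarginals g).pair e14 a d = ∑ b, ∑ c, g (assign a b c d) / ∑ y, g y :=
  pairMarginal_x1_x4 _ a d

theorem normalizedMarginals_pair_e32 (g : (Var → Bit) → ℝ) (c b : Bit) :
    (normalizedMarginals g).pair e32 c b = ∑ a, ∑ d, g (assign a b c d) / ∑ y, g y :=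
  pairMarginal_x3_x2 _ c b

theorem normalizedMarginals_pair_e34 (g : (Var → Bit) → ℝ) (c d : Bit) :
    (normalizedMarginals g).pair e34 c d = ∑ a, ∑ b, g (assign a b c d) / ∑ y, g y :=
  pairMarginal_x3_x4 _ c d

/-- Every assignment violates one or three of `x₁ = x₂`, `x₁ = x₄`, `x₃ = x₂`, `x₃ ≠ x₄`, and
`(0, 0, 1, 1)` violates three. -/
theorem one_add_le_chshSum {g : (Var → Bit) → ℝ} (hg : ∀ x, 0 ≤ g x) (hZ : ∑ x, g x ≠ 0) :
    1 + 2 * (g (assign 0 0 1 1) / ∑ x, g x) ≤ chshSum (normalizedMarginals g) := by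
  have h0 (a b c d) : 0 ≤ g (assign a b c d) / ∑ x, g x :=
    div_nonneg (hg _) (Finset.sum_nonneg fun x _ => hg x)
  have h1 : ∑ a, ∑ b, ∑ c, ∑ d, g (assign a b c d) / ∑ x, g x = 1 := by
    rw [← sum_assign fun y => g y / ∑ x, g x, ← Finset.sum_div, div_self hZ]
  simp only [chshSum, normalizedMarginals_pair_e12, normalizedMarginals_pair_e14,
    normalizedMarginals_pair_e32, normalizedMarginals_pair_e34]
  simp only [Fin.sum_univ_two] at h1 ⊢
  linarith [h0 0 0 0 0, h0 0 0 0 1, h0 0 0 1 0, h0 0 1 0 0, h0 1 0 0 0, h0 0 1 0 1, h0 0 1 1 0,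
    h0 1 0 0 1, h0 1 0 1 0, h0 1 1 0 0, h0 0 1 1 1, h0 1 0 1 1, h0 1 1 0 1, h0 1 1 1 0,
    h0 1 1 1 1]

theorem one_le_chshSum {β : Beliefs} (h : β ∈ singleNode.realizableMarginals) :
    1 ≤ chshSum β := by
  obtain ⟨g, hg, hZ, rfl⟩ := (mem_singleNode_iff β).1 h
  refine le_trans ?_ (one_add_le_chshSum hg hZ)
  have := div_nonneg (hg (assign 0 0 1 1)) (Finset.sum_nonneg fun x (_ : x ∈ Finset.univ) => hg x)
  linarith

/-- A factor of the four-cycle cannot vanish where the corresponding marginal does not. -/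
theorem factors_ne_zero {f12 f14 f32 f34 : Bit → Bit → ℝ≥0} :
    (∀ a b, (normalizedMarginals (cycleProduct f12 f14 f32 f34)).pair e12 a b ≠ 0 →
      f12 a b ≠ 0) ∧
    (∀ a d, (normalizedMarginals (cycleProduct f12 f14 f32 f34)).pair e14 a d ≠ 0 →
      f14 a d ≠ 0) ∧
    (∀ c b, (normalizedMarginals (cycleProduct f12 f14 f32 f34)).pair e32 c b ≠ 0 →
      f32 c b ≠ 0) ∧
    (∀ c d, (normalizedMarginals (cycleProduct f12 f14 f32 f34)).pair e34 c d ≠ 0 →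
      f34 c d ≠ 0) := by
  refine ⟨fun a b => mt fun h => ?_, fun a d => mt fun h => ?_, fun c b => mt fun h => ?_,
    fun c d => mt fun h => ?_⟩
  · simp [normalizedMarginals_pair_e12, cycleProduct, h]
  · simp [normalizedMarginals_pair_e14, cycleProduct, h]
  · simp [normalizedMarginals_pair_e32, cycleProduct, h]
  · simp [normalizedMarginals_pair_e34, cycleProduct, h]

/-- If the CHSH inequality is tight, then `(0, 0, 1, 1)` has probability zero, while a product of
non-zero factors does not vanish there. -/
theorem notMem_fourCycle {β : Beliefs} (h : chshSum β = 1) (h12 : β.pair e12 0 0 ≠ 0)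
    (h14 : β.pair e14 0 1 ≠ 0) (h32 : β.pair e32 1 0 ≠ 0) (h34 : β.pair e34 1 1 ≠ 0) :
    β ∉ fourCycle.realizableMarginals := by
  intro hβ
  obtain ⟨f12, f14, f32, f34, hZ, rfl⟩ := (mem_fourCycle_iff β).1 hβ
  obtain ⟨k12, k14, k32, k34⟩ := @factors_ne_zero f12 f14 f32 f34
  have hg := cycleProduct_nonneg f12 f14 f32 f34
  have h1 := one_add_le_chshSum hg hZ
  have h2 : 0 < cycleProduct f12 f14 f32 f34 (assign 0 0 1 1) := by
    refine (hg _).lt_of_ne' ?_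
    simp [cycleProduct, k12 _ _ h12, k14 _ _ h14, k32 _ _ h32, k34 _ _ h34]
  have h3 := div_pos h2 ((Finset.sum_nonneg fun x _ => hg x).lt_of_ne' hZ)
  linarith

/-- In a Markov chain, `x₃ = 0` and `x₄ = 1` are compatible as soon as both are compatible with
`x₁ = x₂ = 0`. -/
theorem notMem_markovChain {β : Beliefs} (h34 : β.pair e34 0 1 = 0) (h12 : β.pair e12 0 0 ≠ 0)
    (h14 : β.pair e14 0 1 ≠ 0) (h32 : β.pair e32 0 0 ≠ 0) :
    β ∉ markovChain.realizableMarginals := by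
  intro hβ
  obtain ⟨f12, f14, f32, hZ, rfl⟩ := (mem_markovChain_iff β).1 hβ
  obtain ⟨k12, k14, k32, -⟩ := @factors_ne_zero f12 f14 f32 1
  have hg := cycleProduct_nonneg f12 f14 f32 1
  have h0 (x) : 0 ≤ cycleProduct f12 f14 f32 1 x / ∑ y, cycleProduct f12 f14 f32 1 y :=
    div_nonneg (hg x) (Finset.sum_nonneg fun x _ => hg x)
  rw [normalizedMarginals_pair_e34] at h34
  have h1 := (Finset.sum_eq_zero_iff_of_nonneg fun a _ => Finset.sum_nonneg fun b _ => h0 _).1 h34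
    0 (Finset.mem_univ _)
  have h2 := (Finset.sum_eq_zero_iff_of_nonneg fun b _ => h0 _).1 h1 0 (Finset.mem_univ _)
  refine div_ne_zero ?_ hZ h2
  simp [cycleProduct, k12 _ _ h12, k14 _ _ h14, k32 _ _ h32]

/-! ### The probabilities of the two-qubit system -/

/-- The probability of the outcome `(a, b)` when the two qubits in the state `ρ` are measured in
the bases given by the rows of `V` and `W`, as a complex number. -/
def bornProb (ρ : Matrix (Bit × Bit) (Bit × Bit) ℂ) (V W : Matrix Bit Bit ℂ) (a b : Bit) : ℂ :=
  ∑ x, ∑ y, ∑ x', ∑ y', ρ (x, y) (x', y') * (V a x * star (V a x')) * (W b y * star (W b y'))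

theorem sum_mul_star_col {U : Matrix Bit Bit ℂ} (hU : U ∈ Matrix.unitaryGroup Bit ℂ)
    (x x' : Bit) : U 0 x * star (U 0 x') + U 1 x * star (U 1 x') = if x = x' then 1 else 0 := by
  have h := congrFun (congrFun (Matrix.mem_unitaryGroup_iff'.1 hU) x') x
  simp only [Matrix.mul_apply, Matrix.star_apply, Fin.sum_univ_two, Matrix.one_apply] at h
  simp only [eq_comm (a := x), ← h]
  ring

theorem sum_mul_star_row {U : Matrix Bit Bit ℂ} (hU : U ∈ Matrix.unitaryGroup Bit ℂ)
    (a : Bit) : U a 0 * star (U a 0) + U a 1 * star (U a 1) = 1 := by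
  have h := congrFun (congrFun (Matrix.mem_unitaryGroup_iff.1 hU) a) a
  simpa [Matrix.mul_apply, Matrix.star_apply, Fin.sum_univ_two] using h

section Born

variable (ρ : Matrix (Bit × Bit) (Bit × Bit) ℂ)

/-- The distribution of the outcome for the first qubit does not depend on the measurement of the
second one. -/
theorem sum_bornProb_right (V : Matrix Bit Bit ℂ) {W : Matrix Bit Bit ℂ}
    (hW : W ∈ Matrix.unitaryGroup Bit ℂ) (a : Bit) :
    ∑ b, bornProb ρ V W a b = ∑ x, ∑ y, ∑ x', ρ (x, y) (x', y) * (V a x * star (V a x')) := by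
  have h (y y') := sum_mul_star_col hW y y'
  have h01 := (h 0 1).trans (if_neg (by decide))
  have h10 := (h 1 0).trans (if_neg (by decide))
  have h00 := (h 0 0).trans (if_pos rfl)
  have h11 := (h 1 1).trans (if_pos rfl)
  simp only [bornProb, Fin.sum_univ_two]
  linear_combination (norm := skip)
    (∑ x, ∑ x', ρ (x, 0) (x', 0) * (V a x * star (V a x'))) * h00 +
    (∑ x, ∑ x', ρ (x, 0) (x', 1) * (V a x * star (V a x'))) * h01 +
    (∑ x, ∑ x', ρ (x, 1) (x', 0) * (V a x * star (V a x'))) * h10 +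
    (∑ x, ∑ x', ρ (x, 1) (x', 1) * (V a x * star (V a x'))) * h11
  simp only [Fin.sum_univ_two]
  ring

/-- Exchanging the qubits. -/
theorem bornProb_swap (V W : Matrix Bit Bit ℂ) (a b : Bit) :
    bornProb (ρ.submatrix Prod.swap Prod.swap) W V b a = bornProb ρ V W a b := by
  simp only [bornProb, Fin.sum_univ_two, Matrix.submatrix_apply, Prod.swap_prod_mk]
  ring

theorem sum_bornProb_left {V : Matrix Bit Bit ℂ} (W : Matrix Bit Bit ℂ)
    (hV : V ∈ Matrix.unitaryGroup Bit ℂ) (b : Bit) :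
    ∑ a, bornProb ρ V W a b = ∑ y, ∑ x, ∑ y', ρ (x, y) (x, y') * (W b y * star (W b y')) := by
  simp only [← bornProb_swap ρ]
  exact sum_bornProb_right _ W hV b

theorem sum_bornProb {V W : Matrix Bit Bit ℂ} (hV : V ∈ Matrix.unitaryGroup Bit ℂ)
    (hW : W ∈ Matrix.unitaryGroup Bit ℂ) : ∑ a, ∑ b, bornProb ρ V W a b = ρ.trace := by
  have h (x x') := sum_mul_star_col hV x x'
  have h01 := (h 0 1).trans (if_neg (by decide))
  have h10 := (h 1 0).trans (if_neg (by decide))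
  have h00 := (h 0 0).trans (if_pos rfl)
  have h11 := (h 1 1).trans (if_pos rfl)
  simp only [sum_bornProb_right ρ V hW, Fin.sum_univ_two, Matrix.trace, Fintype.sum_prod_type,
    Matrix.diag_apply]
  linear_combination (norm := skip)
    (∑ y, ρ (0, y) (0, y)) * h00 + (∑ y, ρ (0, y) (1, y)) * h01 +
    (∑ y, ρ (1, y) (0, y)) * h10 + (∑ y, ρ (1, y) (1, y)) * h11
  simp only [Fin.sum_univ_two]
  ring

theorem bornProb_nonneg {ρ : Matrix (Bit × Bit) (Bit × Bit) ℂ} (hρ : ρ.PosSemidef)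
    (V W : Matrix Bit Bit ℂ) (a b : Bit) : 0 ≤ bornProb ρ V W a b := by
  have h := hρ.dotProduct_mulVec_nonneg fun z => star (V a z.1 * W b z.2)
  convert h using 1
  simp only [bornProb, dotProduct, Matrix.mulVec, Fintype.sum_prod_type, Fin.sum_univ_two,
    Pi.star_apply, star_star, star_mul']
  ring

theorem bornProb_one_one (a b : Bit) : bornProb ρ 1 1 a b = ρ (a, b) (a, b) := by
  simp [bornProb, Matrix.one_apply]

theorem bornProb_one_left (W : Matrix Bit Bit ℂ) (a b : Bit) :
    bornProb ρ 1 W a b = ∑ y, ∑ y', ρ (a, y) (a, y') * (W b y * star (W b y')) := by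
  simp [bornProb, Matrix.one_apply]

theorem bornProb_one_right (V : Matrix Bit Bit ℂ) (a b : Bit) :
    bornProb ρ V 1 a b = ∑ x, ∑ x', ρ (x, b) (x', b) * (V a x * star (V a x')) := by
  simp [bornProb, Matrix.one_apply]

variable {U₁ U₂ : Matrix Bit Bit ℂ}

theorem pairMarginal_x1_x2_quantumMassFunction (hU₁ : U₁ ∈ Matrix.unitaryGroup Bit ℂ)
    (hU₂ : U₂ ∈ Matrix.unitaryGroup Bit ℂ) (a b : Bit) :
    pairMarginal (quantumMassFunction ρ U₁ U₂) .x1 .x2 (a, a) (b, b) = bornProb ρ 1 1 a b := by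
  have h1 := (sum_mul_star_col hU₁ a a).trans (if_pos rfl)
  have h2 := (sum_mul_star_col hU₂ b b).trans (if_pos rfl)
  rw [pairMarginal_x1_x2, bornProb_one_one]
  simp only [quantumMassFunction, Fintype.sum_prod_type, Fin.sum_univ_two, assign_x1, assign_x2,
    assign_x3, assign_x4, Matrix.conjTranspose_apply, Matrix.one_apply, Fin.isValue, zero_ne_one,
    one_ne_zero, if_true, if_false]
  linear_combination ρ (a, b) (a, b) * h1 +
    ρ (a, b) (a, b) * (U₁ 0 a * star (U₁ 0 a) + U₁ 1 a * star (U₁ 1 a)) * h2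

theorem pairMarginal_x1_x4_quantumMassFunction (hU₁ : U₁ ∈ Matrix.unitaryGroup Bit ℂ)
    (a d : Bit) :
    pairMarginal (quantumMassFunction ρ U₁ U₂) .x1 .x4 (a, a) (d, d) = bornProb ρ 1 U₂ a d := by
  have h1 := (sum_mul_star_col hU₁ a a).trans (if_pos rfl)
  rw [pairMarginal_x1_x4, bornProb_one_left]
  simp only [quantumMassFunction, Fintype.sum_prod_type, Fin.sum_univ_two, assign_x1, assign_x2,
    assign_x3, assign_x4, Matrix.conjTranspose_apply, Matrix.one_apply, Fin.isValue, zero_ne_one,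
    one_ne_zero, if_true, if_false]
  linear_combination (norm := skip)
    (∑ y, ∑ y', ρ (a, y) (a, y') * (U₂ d y * star (U₂ d y'))) * h1
  simp only [Fin.sum_univ_two]
  ring

theorem pairMarginal_x3_x2_quantumMassFunction (hU₂ : U₂ ∈ Matrix.unitaryGroup Bit ℂ)
    (c b : Bit) :
    pairMarginal (quantumMassFunction ρ U₁ U₂) .x3 .x2 (c, c) (b, b) = bornProb ρ U₁ 1 c b := by
  have h2 := (sum_mul_star_col hU₂ b b).trans (if_pos rfl)
  rw [pairMarginal_x3_x2, bornProb_one_right]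
  simp only [quantumMassFunction, Fintype.sum_prod_type, Fin.sum_univ_two, assign_x1, assign_x2,
    assign_x3, assign_x4, Matrix.conjTranspose_apply, Matrix.one_apply, Fin.isValue, zero_ne_one,
    one_ne_zero, if_true, if_false]
  linear_combination (norm := skip)
    (∑ x, ∑ x', ρ (x, b) (x', b) * (U₁ c x * star (U₁ c x'))) * h2
  simp only [Fin.sum_univ_two]
  ring

theorem pairMarginal_x3_x4_quantumMassFunction (c d : Bit) :
    pairMarginal (quantumMassFunction ρ U₁ U₂) .x3 .x4 (c, c) (d, d) = bornProb ρ U₁ U₂ c d := by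
  rw [pairMarginal_x3_x4, bornProb]
  simp only [quantumMassFunction, Fintype.sum_prod_type, Fin.sum_univ_two, assign_x1, assign_x2,
    assign_x3, assign_x4, Matrix.conjTranspose_apply, Matrix.one_apply, if_true]
  ring

/-- Every term of a marginal with `x₄ ≠ x₄'` vanishes. -/
theorem pairMarginal_quantumMassFunction_of_x4 (i : Var) (a d : Bit × Bit) (hd : d.1 ≠ d.2) :
    pairMarginal (quantumMassFunction ρ U₁ U₂) i .x4 a d = 0 := by
  refine Finset.sum_eq_zero fun x hx => ?_
  have h : x .x4 = d := (Finset.mem_filter.1 hx).2.2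
  simp [quantumMassFunction, h, Matrix.one_apply, hd]

/-- Every term of a marginal with `x₃ ≠ x₃'` vanishes. -/
theorem pairMarginal_quantumMassFunction_of_x3 (j : Var) (c b : Bit × Bit) (hc : c.1 ≠ c.2) :
    pairMarginal (quantumMassFunction ρ U₁ U₂) .x3 j c b = 0 := by
  refine Finset.sum_eq_zero fun x hx => ?_
  have h : x .x3 = c := (Finset.mem_filter.1 hx).2.1
  simp [quantumMassFunction, h, Matrix.one_apply, hc]

theorem singleMarginal_quantumMassFunction_eq_sum_x4 (i : Var) (a : Bit × Bit) :
    singleMarginal (quantumMassFunction ρ U₁ U₂) i a =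
      ∑ d : Bit, pairMarginal (quantumMassFunction ρ U₁ U₂) i .x4 a (d, d) := by
  have h (d d' : Bit) := pairMarginal_quantumMassFunction_of_x4 ρ (U₁ := U₁) (U₂ := U₂) i a (d, d')
  rw [← sum_pairMarginal_right _ i .x4, Fintype.sum_prod_type]
  simp [Fin.sum_univ_two, h]

theorem singleMarginal_quantumMassFunction_eq_sum_x3 (j : Var) (b : Bit × Bit) :
    singleMarginal (quantumMassFunction ρ U₁ U₂) j b =
      ∑ c : Bit, pairMarginal (quantumMassFunction ρ U₁ U₂) .x3 j (c, c) b := by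
  have h (c c' : Bit) := pairMarginal_quantumMassFunction_of_x3 ρ (U₁ := U₁) (U₂ := U₂) j (c, c') b
  rw [← sum_pairMarginal_left _ .x3 j, Fintype.sum_prod_type]
  simp [Fin.sum_univ_two, h]

end Born

/-- The quantum marginals are the probabilities of the outcomes when each qubit is measured in the
standard basis or in the basis given by the rows of a unitary matrix. -/
theorem mem_quantumMarginals_iff (β : Beliefs) : β ∈ quantumMarginals ↔
    ∃ (ρ : Matrix (Bit × Bit) (Bit × Bit) ℂ) (U₁ U₂ : Matrix Bit Bit ℂ),
      ρ.PosSemidef ∧ ρ.trace = 1 ∧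
      U₁ ∈ Matrix.unitaryGroup Bit ℂ ∧ U₂ ∈ Matrix.unitaryGroup Bit ℂ ∧
      (∀ a b, (β.pair e12 a b : ℂ) = bornProb ρ 1 1 a b) ∧
      (∀ a d, (β.pair e14 a d : ℂ) = bornProb ρ 1 U₂ a d) ∧
      (∀ c b, (β.pair e32 c b : ℂ) = bornProb ρ U₁ 1 c b) ∧
      (∀ c d, (β.pair e34 c d : ℂ) = bornProb ρ U₁ U₂ c d) ∧
      (∀ a, β.single .x1 a = ∑ d, β.pair e14 a d) ∧
      (∀ b, β.single .x2 b = ∑ c, β.pair e32 c b) ∧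
      (∀ c, β.single .x3 c = ∑ d, β.pair e34 c d) ∧
      ∀ d, β.single .x4 d = ∑ c, β.pair e34 c d := by
  refine exists_congr fun ρ => exists_congr fun U₁ => exists_congr fun U₂ => ?_
  refine and_congr_right fun _ => and_congr_right fun _ => and_congr_right fun h1 =>
    and_congr_right fun h2 => ?_
  have hv {P : Var → Prop} : (∀ i, P i) ↔ P .x1 ∧ P .x2 ∧ P .x3 ∧ P .x4 :=
    ⟨fun h => ⟨h _, h _, h _, h _⟩, fun ⟨h1, h2, h3, h4⟩ i => by cases i <;> assumption⟩
  rw [forall_K, hv]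
  simp only [pairMarginal_x1_x2_quantumMassFunction ρ h1 h2,
    pairMarginal_x1_x4_quantumMassFunction ρ h1, pairMarginal_x3_x2_quantumMassFunction ρ h2,
    pairMarginal_x3_x4_quantumMassFunction, singleMarginal_quantumMassFunction_eq_sum_x4 ρ .x1,
    singleMarginal_quantumMassFunction_eq_sum_x3 ρ .x2,
    singleMarginal_quantumMassFunction_eq_sum_x4 ρ .x3,
    singleMarginal_quantumMassFunction_eq_sum_x3 ρ .x4, and_assoc]
  refine and_congr_right fun _ => and_congr_right fun k14 => and_congr_right fun k32 =>
    and_congr_right fun k34 => ?_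
  simp only [← k14, ← k32, ← k34]
  norm_cast

theorem quantumMarginals_subset_localMarginalPolytope :
    quantumMarginals ⊆ localMarginalPolytope := by
  intro β hβ
  obtain ⟨ρ, U₁, U₂, hρ, ht, h1, h2, k12, k14, k32, k34, s1, s2, s3, s4⟩ :=
    (mem_quantumMarginals_iff β).1 hβ
  have hI : (1 : Matrix Bit Bit ℂ) ∈ Matrix.unitaryGroup Bit ℂ := one_mem _
  have r1 (a) : ∑ b, β.pair e12 a b = ∑ d, β.pair e14 a d := by
    apply Complex.ofReal_injective
    push_cast
    simp only [k12, k14, sum_bornProb_right ρ _ hI, sum_bornProb_right ρ _ h2]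
  have r2 (b) : ∑ a, β.pair e12 a b = ∑ c, β.pair e32 c b := by
    apply Complex.ofReal_injective
    push_cast
    simp only [k12, k32, sum_bornProb_left ρ _ hI, sum_bornProb_left ρ _ h1]
  have r3 (c) : ∑ b, β.pair e32 c b = ∑ d, β.pair e34 c d := by
    apply Complex.ofReal_injective
    push_cast
    simp only [k32, k34, sum_bornProb_right ρ _ hI, sum_bornProb_right ρ _ h2]
  have r4 (d) : ∑ a, β.pair e14 a d = ∑ c, β.pair e34 c d := by
    apply Complex.ofReal_injective
    push_cast
    simp only [k14, k34, sum_bornProb_left ρ _ hI, sum_bornProb_left ρ _ h1]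
  have t14 : ∑ a, ∑ d, β.pair e14 a d = 1 := by
    apply Complex.ofReal_injective
    push_cast
    simp only [k14, sum_bornProb ρ hI h2, ht]
  have t34 : ∑ c, ∑ d, β.pair e34 c d = 1 := by
    apply Complex.ofReal_injective
    push_cast
    simp only [k34, sum_bornProb ρ h1 h2, ht]
  have t32 : ∑ c, ∑ b, β.pair e32 c b = 1 := by simp only [r3, t34]
  refine mem_localMarginalPolytope_of_nonneg ?_ ?_ ?_ ?_
  · have h (r : ℝ) (z : ℂ) (hr : (r : ℂ) = z) (hz : 0 ≤ z) : 0 ≤ r := by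
      rwa [← hr, Complex.zero_le_real] at hz
    rw [forall_K]
    exact ⟨fun a b => h _ _ (k12 a b) (bornProb_nonneg hρ _ _ _ _),
      fun a b => h _ _ (k14 a b) (bornProb_nonneg hρ _ _ _ _),
      fun a b => h _ _ (k32 a b) (bornProb_nonneg hρ _ _ _ _),
      fun a b => h _ _ (k34 a b) (bornProb_nonneg hρ _ _ _ _)⟩
  · rw [forall_K]
    exact ⟨fun a => (r1 a).trans (s1 a).symm, fun a => (s1 a).symm,
      fun c => (r3 c).trans (s3 c).symm, fun c => (s3 c).symm⟩
  · rw [forall_K]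
    exact ⟨fun b => (r2 b).trans (s2 b).symm, fun d => (r4 d).trans (s4 d).symm,
      fun b => (s2 b).symm, fun d => (s4 d).symm⟩
  · intro i
    cases i
    · simpa only [s1] using t14
    · simp only [s2]
      rw [Finset.sum_comm]
      exact t32
    · simpa only [s3] using t34
    · simp only [s4]
      rw [Finset.sum_comm]
      exact t34

/-! ### An obstruction to quantum realizability -/

/-- A zero on the diagonal of a positive semidefinite matrix forces its row to vanish. -/
theorem row_eq_zero_of_diag_eq_zero {n : Type*} [Fintype n] {ρ : Matrix n n ℂ}
    (hρ : ρ.PosSemidef) {i : n} (hi : ρ i i = 0) (j : n) : ρ i j = 0 := by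
  obtain ⟨m, v, rfl⟩ := Matrix.posSemidef_iff_eq_sum_vecMulVec.1 hρ
  simp only [Matrix.sum_apply, Matrix.vecMulVec_apply, Pi.star_apply] at hi ⊢
  rw [Finset.sum_eq_zero_iff_of_nonneg fun k _ => mul_star_self_nonneg (v k i)] at hi
  refine Finset.sum_eq_zero fun k hk => ?_
  have h : v k i = 0 := by simpa using hi k hk
  rw [h, zero_mul]

/-- If `x₁ = x₂` almost surely, then the coherences `⟨00|ρ|01⟩` and `⟨11|ρ|10⟩` vanish, so that `x₄`
is the output of the channel `|U₂|²` with input `x₁`. This channel is doubly stochastic: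
`P(x₄ = 0 | x₁ = 0) = P(x₄ = 1 | x₁ = 1)`. -/
theorem pair_e14_of_pair_e12_eq_zero {β : Beliefs} (hβ : β ∈ quantumMarginals)
    (h01 : β.pair e12 0 1 = 0) (h10 : β.pair e12 1 0 = 0) :
    β.pair e14 0 0 * β.pair e12 1 1 = β.pair e14 1 1 * β.pair e12 0 0 := by
  obtain ⟨ρ, U₁, U₂, hρ, -, -, h2, k12, k14, -⟩ := (mem_quantumMarginals_iff β).1 hβ
  simp only [bornProb_one_one] at k12
  simp only [bornProb_one_left, Fin.sum_univ_two] at k14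
  have e1 : ρ (0, 1) (0, 1) = 0 := by rw [← k12, h01, Complex.ofReal_zero]
  have e2 : ρ (1, 0) (1, 0) = 0 := by rw [← k12, h10, Complex.ofReal_zero]
  have z1 := row_eq_zero_of_diag_eq_zero hρ e1 (0, 0)
  have z2 := row_eq_zero_of_diag_eq_zero hρ e2 (1, 1)
  have z3 : ρ (0, 0) (0, 1) = 0 := by rw [← hρ.isHermitian.apply, z1, star_zero]
  have z4 : ρ (1, 1) (1, 0) = 0 := by rw [← hρ.isHermitian.apply, z2, star_zero]
  have hc := (sum_mul_star_col h2 0 0).trans (if_pos rfl)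
  have hr := sum_mul_star_row h2 1
  apply Complex.ofReal_injective
  push_cast
  rw [k14, k14, k12, k12, e1, e2, z1, z2, z3, z4]
  linear_combination ρ (0, 0) (0, 0) * ρ (1, 1) (1, 1) * (hc - hr)

/-! ### Collections with uniform single-variable marginals -/

/-- The value `±1` of a bit. -/
def sgn : Bit → ℝ := ![1, -1]

/-- The collection with uniform single-variable marginals and with the correlation `t e` of the
`±1`-valued variables of each pair `e`. -/
noncomputable def corrBeliefs (t : K → ℝ) : Beliefs where
  pair e a b := (1 + sgn a * sgn b * t e) / 4
  single _ _ := 1 / 2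

/-- The matrix `(I + t₁₂ Z ⊗ Z + t₁₄ Z ⊗ X + t₃₂ X ⊗ Z + t₃₄ X ⊗ X + s Y ⊗ Y) / 4`, where `X`, `Y`,
`Z` are the Pauli matrices. -/
noncomputable def pauliState (t : K → ℝ) (s : ℝ) : Matrix (Bit × Bit) (Bit × Bit) ℂ :=
  Matrix.of fun x y =>
    (((if x.1 = y.1 then if x.2 = y.2 then 1 + sgn x.1 * sgn x.2 * t e12 else sgn x.1 * t e14
      else if x.2 = y.2 then sgn x.2 * t e32 else t e34 - sgn x.1 * sgn x.2 * s) / 4 : ℝ) : ℂ)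

/-- The Hadamard matrix, whose rows are the eigenvectors of the Pauli matrix `X`. -/
noncomputable def hadamard : Matrix Bit Bit ℂ :=
  !![(√2 / 2 : ℝ), (√2 / 2 : ℝ); (√2 / 2 : ℝ), -(√2 / 2 : ℝ)]

theorem hadamard_mul_star (a x x' : Bit) :
    hadamard a x * star (hadamard a x') = if x = x' then 1 / 2 else (sgn a / 2 : ℝ) := by
  have h : (((√2 / 2 : ℝ) : ℂ)) * ((√2 / 2 : ℝ) : ℂ) = 1 / 2 := by
    rw [← Complex.ofReal_mul, div_mul_div_comm, Real.mul_self_sqrt zero_le_two]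
    norm_num
  have h' : ((√2 : ℂ) / 2) * ((√2 : ℂ) / 2) = 1 / 2 := by simpa using h
  fin_cases a <;> fin_cases x <;> fin_cases x' <;> simp [hadamard, sgn, h'] <;> norm_num

theorem hadamard_mem_unitaryGroup : hadamard ∈ Matrix.unitaryGroup Bit ℂ := by
  have h := hadamard_mul_star
  rw [Matrix.mem_unitaryGroup_iff']
  ext x x'
  have h0 := h 0 x' x
  have h1 := h 1 x' x
  simp only [Matrix.mul_apply, Fin.sum_univ_two, Matrix.star_apply, mul_comm (star _), h0, h1,
    Matrix.one_apply, eq_comm (a := x)]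
  split_ifs <;> norm_num [sgn]

theorem corrBeliefs_mem_quantumMarginals {t : K → ℝ} {s : ℝ} (h : (pauliState t s).PosSemidef) :
    corrBeliefs t ∈ quantumMarginals := by
  have hH := hadamard_mem_unitaryGroup
  refine (mem_quantumMarginals_iff _).2 ⟨_, hadamard, hadamard, h, ?_, hH, hH, fun a b => ?_,
    fun a b => ?_, fun a b => ?_, fun a b => ?_, fun a => ?_, fun a => ?_, fun a => ?_,
    fun a => ?_⟩
  · simp [Matrix.trace, Fintype.sum_prod_type, pauliState, sgn]
    ring
  · rw [bornProb_one_one]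
    simp [pauliState, corrBeliefs]
  · simp only [bornProb_one_left, hadamard_mul_star]
    fin_cases a <;> fin_cases b <;> simp [pauliState, corrBeliefs, sgn] <;> ring
  · simp only [bornProb_one_right, hadamard_mul_star]
    fin_cases a <;> fin_cases b <;> simp [pauliState, corrBeliefs, sgn] <;> ring
  · simp only [bornProb, hadamard_mul_star]
    fin_cases a <;> fin_cases b <;> simp [pauliState, corrBeliefs, sgn] <;> ring
  all_goals
    simp [corrBeliefs, sgn]
    ring

/-- The correlations `(α, α, α, -α)` are quantum up to Tsirelson's bound `α = √2 / 2`: with `s = 1`,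
the matrix is supported on the span of the Bell vectors `u = e₀₀ - e₁₁` and `v = e₀₁ + e₁₀`. -/
theorem posSemidef_pauliState_chsh {α : ℝ} (h1 : α < 1) (h2 : 2 * α ^ 2 ≤ 1) :
    (pauliState (onPairs α α α (-α)) 1).PosSemidef := by
  have h1' : 0 < 1 - α := sub_pos.2 h1
  let u : Bit × Bit → ℂ := fun x => ((if x.1 = x.2 then sgn x.1 else 0 : ℝ) : ℂ)
  -- completing the square: `v + α / (1 - α) • u`
  let w : Bit × Bit → ℂ := fun x => ((if x.1 = x.2 then α / (1 - α) * sgn x.1 else 1 : ℝ) : ℂ)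
  have key : pauliState (onPairs α α α (-α)) 1 =
      (((1 - α) / 4 : ℝ) : ℂ) • Matrix.vecMulVec w (star w) +
        (((1 - 2 * α ^ 2) / (1 - α) / 4 : ℝ) : ℂ) • Matrix.vecMulVec u (star u) := by
    ext ⟨a, b⟩ ⟨a', b'⟩
    simp only [pauliState, Matrix.of_apply, Matrix.add_apply, Matrix.smul_apply, smul_eq_mul,
      Matrix.vecMulVec_apply, Pi.star_apply, u, w, Complex.star_def, Complex.conj_ofReal]
    norm_cast
    fin_cases a <;> fin_cases b <;> fin_cases a' <;> fin_cases b' <;> simp [sgn] <;>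
      field_simp <;> ring
  rw [key]
  refine ((Matrix.posSemidef_vecMulVec_self_star w).smul ?_).add
    ((Matrix.posSemidef_vecMulVec_self_star u).smul ?_)
  · exact Complex.zero_le_real.2 (by positivity)
  · exact Complex.zero_le_real.2 (div_nonneg (div_nonneg (by linarith) h1'.le) (by norm_num))

/-- The equal mixture of the projections onto two Bell states. -/
theorem posSemidef_pauliState_x3_x4 :
    (pauliState (onPairs 0 0 0 1) 0).PosSemidef := by
  let u : Bit × Bit → ℂ := fun x => ((if x.1 = x.2 then 1 else 0 : ℝ) : ℂ)
  let w : Bit × Bit → ℂ := fun x => ((if x.1 = x.2 then 0 else 1 : ℝ) : ℂ)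
  have key : pauliState (onPairs 0 0 0 1) 0 =
      ((1 / 4 : ℝ) : ℂ) • (Matrix.vecMulVec w (star w) + Matrix.vecMulVec u (star u)) := by
    ext ⟨a, b⟩ ⟨a', b'⟩
    simp only [pauliState, Matrix.of_apply, Matrix.add_apply, Matrix.smul_apply, smul_eq_mul,
      Matrix.vecMulVec_apply, Pi.star_apply, u, w, Complex.star_def, Complex.conj_ofReal]
    norm_cast
    fin_cases a <;> fin_cases b <;> fin_cases a' <;> fin_cases b' <;> simp
  rw [key]
  exact ((Matrix.posSemidef_vecMulVec_self_star w).add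
    (Matrix.posSemidef_vecMulVec_self_star u)).smul (Complex.zero_le_real.2 (by norm_num))

/-! ### Points of the eight regions -/

/-- The single-variable marginals of a point of the local marginal polytope are determined by the
pairwise ones. -/
theorem eq_of_pair_eq {β γ : Beliefs} (hβ : β ∈ localMarginalPolytope)
    (hγ : γ ∈ localMarginalPolytope) (h : ∀ e a b, β.pair e a b = γ.pair e a b) : β = γ := by
  obtain ⟨-, β1, β2, -⟩ := hβ
  obtain ⟨-, γ1, γ2, -⟩ := hγ
  ext e a b
  · exact h e a b
  cases e
  · rw [← β1 e12, ← γ1 e12]; simp only [h]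
  · rw [← β2 e12, ← γ2 e12]; simp only [h]
  · rw [← β1 e34, ← γ1 e34]; simp only [h]
  · rw [← β2 e34, ← γ2 e34]; simp only [h]

theorem corrBeliefs_eq_normalizedMarginals {t : K → ℝ} (ht : corrBeliefs t ∈ quantumMarginals)
    {g : (Var → Bit) → ℝ} (hg : ∀ x, 0 ≤ g x) (hZ : ∑ x, g x ≠ 0)
    (h : ∀ e a b, (corrBeliefs t).pair e a b = (normalizedMarginals g).pair e a b) :
    corrBeliefs t = normalizedMarginals g :=
  eq_of_pair_eq (quantumMarginals_subset_localMarginalPolytope ht)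
    (singleNode_subset_localMarginalPolytope ((mem_singleNode_iff _).2 ⟨g, hg, hZ, rfl⟩)) h

/-- The independent uniform variables, and the maximally mixed state. -/
theorem nonempty_markovChain_inter_quantumMarginals :
    (markovChain.realizableMarginals ∩ quantumMarginals).Nonempty := by
  have hQ := corrBeliefs_mem_quantumMarginals
    (posSemidef_pauliState_chsh (α := 0) (by norm_num) (by norm_num))
  refine ⟨_, (mem_markovChain_iff _).2 ⟨1, 1, 1, ?_⟩, hQ⟩
  have hZ : ∑ x, cycleProduct 1 1 1 1 x = 16 := by
    rw [sum_assign]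
    simp [cycleProduct]
    norm_num
  have hZ0 : ∑ x, cycleProduct 1 1 1 1 x ≠ 0 := by norm_num [hZ]
  refine ⟨hZ0, corrBeliefs_eq_normalizedMarginals hQ (cycleProduct_nonneg _ _ _ _) hZ0 ?_⟩
  simp only [forall_K, normalizedMarginals_pair_e12, normalizedMarginals_pair_e14,
    normalizedMarginals_pair_e32, normalizedMarginals_pair_e34, hZ, Fin.forall_fin_two]
  norm_num [corrBeliefs, cycleProduct]

/-- The bit `x₁ = x₂` is sent to `x₄` through a channel which is not doubly stochastic. -/
theorem nonempty_markovChain_diff_quantumMarginals :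
    (markovChain.realizableMarginals \ quantumMarginals).Nonempty := by
  obtain ⟨g, hg⟩ : ∃ g, g = cycleProduct ![![1, 0], ![0, 1]] ![![1, 1], ![1, 0]] 1 1 := ⟨_, rfl⟩
  have hZ : ∑ x, g x = 6 := by
    rw [sum_assign]
    simp [cycleProduct, hg]
    norm_num
  refine ⟨normalizedMarginals g, (mem_markovChain_iff _).2 ⟨_, _, _, ?_, by rw [hg]⟩, ?_⟩
  · norm_num [← hg, hZ]
  intro hQ
  have := pair_e14_of_pair_e12_eq_zero hQ
  simp only [normalizedMarginals_pair_e12, normalizedMarginals_pair_e14, hZ, Fin.sum_univ_two]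
    at this
  norm_num [hg, cycleProduct] at this

/-- Perfectly correlated `x₃` and `x₄`, which are both independent of `x₁` and `x₂`. -/
theorem nonempty_fourCycle_inter_quantumMarginals_diff_markovChain :
    ((fourCycle.realizableMarginals ∩ quantumMarginals) \
      markovChain.realizableMarginals).Nonempty := by
  have hQ := corrBeliefs_mem_quantumMarginals posSemidef_pauliState_x3_x4
  refine ⟨_, ⟨(mem_fourCycle_iff _).2 ⟨1, 1, 1, ![![1, 0], ![0, 1]], ?_⟩, hQ⟩,
    notMem_markovChain ?_ ?_ ?_ ?_⟩
  · have hZ : ∑ x, cycleProduct 1 1 1 ![![1, 0], ![0, 1]] x = 8 := by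
      rw [sum_assign]
      simp [cycleProduct]
      norm_num
    have hZ0 : ∑ x, cycleProduct 1 1 1 ![![1, 0], ![0, 1]] x ≠ 0 := by norm_num [hZ]
    refine ⟨hZ0, corrBeliefs_eq_normalizedMarginals hQ (cycleProduct_nonneg _ _ _ _) hZ0 ?_⟩
    simp only [forall_K, normalizedMarginals_pair_e12, normalizedMarginals_pair_e14,
      normalizedMarginals_pair_e32, normalizedMarginals_pair_e34, hZ, Fin.forall_fin_two]
    norm_num [corrBeliefs, sgn, cycleProduct]
  all_goals norm_num [corrBeliefs, sgn]

/-- The bit `x₁ = x₂` is sent to `x₄` through a channel which is not doubly stochastic, and `x₃`,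
`x₄` are dependent given this bit. -/
theorem nonempty_fourCycle_diff :
    (fourCycle.realizableMarginals \
      (markovChain.realizableMarginals ∪ quantumMarginals)).Nonempty := by
  obtain ⟨g, hg⟩ : ∃ g, g =
    cycleProduct ![![1, 0], ![0, 1]] ![![1, 1], ![1, 0]] 1 ![![1, 0], ![1, 1]] := ⟨_, rfl⟩
  have hZ : ∑ x, g x = 5 := by
    rw [sum_assign]
    simp [cycleProduct, hg]
    norm_num
  refine ⟨normalizedMarginals g, (mem_fourCycle_iff _).2 ⟨_, _, _, _, ?_, by rw [hg]⟩, ?_⟩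
  · norm_num [← hg, hZ]
  rw [Set.mem_union, not_or]
  constructor
  · apply notMem_markovChain <;>
    simp only [normalizedMarginals_pair_e12, normalizedMarginals_pair_e14,
      normalizedMarginals_pair_e32, normalizedMarginals_pair_e34, hZ, Fin.sum_univ_two] <;>
    norm_num [hg, cycleProduct]
  · intro hQ
    have := pair_e14_of_pair_e12_eq_zero hQ
    simp only [normalizedMarginals_pair_e12, normalizedMarginals_pair_e14, hZ, Fin.sum_univ_two]
      at this
    norm_num [hg, cycleProduct] at this

/-- The uniform mixture of the eight assignments with the least contribution to the CHSH sum. All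
correlations are `±1 / 2`, so that no pairwise marginal vanishes. -/
theorem nonempty_singleNode_inter_quantumMarginals_diff_fourCycle :
    ((singleNode.realizableMarginals ∩ quantumMarginals) \
      fourCycle.realizableMarginals).Nonempty := by
  have hQ := corrBeliefs_mem_quantumMarginals
    (posSemidef_pauliState_chsh (α := 1 / 2) (by norm_num) (by norm_num))
  obtain ⟨g, hg⟩ : ∃ g : (Var → Bit) → ℝ, g = fun x =>
    if x .x2 = x .x4 then if x .x1 = x .x2 then 1 else 0
    else if x .x3 = x .x2 then 1 else 0 := ⟨_, rfl⟩
  have hg0 (x) : 0 ≤ g x := by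
    simp only [hg]
    split_ifs <;> norm_num
  have hZ : ∑ x, g x = 8 := by
    rw [sum_assign]
    simp [hg]
    norm_num
  have hZ0 : ∑ x, g x ≠ 0 := by norm_num [hZ]
  refine ⟨_, ⟨(mem_singleNode_iff _).2 ⟨g, hg0, hZ0,
    corrBeliefs_eq_normalizedMarginals hQ hg0 hZ0 ?_⟩, hQ⟩, notMem_fourCycle ?_ ?_ ?_ ?_ ?_⟩
  · simp only [forall_K, normalizedMarginals_pair_e12, normalizedMarginals_pair_e14,
      normalizedMarginals_pair_e32, normalizedMarginals_pair_e34, hZ, Fin.forall_fin_two,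
      Fin.sum_univ_two]
    norm_num [corrBeliefs, sgn, hg]
  all_goals norm_num [chshSum, corrBeliefs, sgn]

/-- The uniform mixture of three assignments with `x₁ = x₂` and with the least contribution to the
CHSH sum. -/
theorem nonempty_singleNode_diff :
    (singleNode.realizableMarginals \
      (fourCycle.realizableMarginals ∪ quantumMarginals)).Nonempty := by
  obtain ⟨g, hg⟩ : ∃ g : (Var → Bit) → ℝ, g = fun x =>
    if x = assign 0 0 0 1 ∨ x = assign 0 0 1 0 ∨ x = assign 1 1 1 1 then 1 else 0 := ⟨_, rfl⟩
  have hg0 (x) : 0 ≤ g x := by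
    simp only [hg]
    split_ifs <;> norm_num
  have hinj (a b c d a' b' c' d' : Bit) : assign a b c d = assign a' b' c' d' ↔
      a = a' ∧ b = b' ∧ c = c' ∧ d = d' := by
    refine ⟨fun h => ⟨congrFun h .x1, congrFun h .x2, congrFun h .x3, congrFun h .x4⟩, ?_⟩
    rintro ⟨rfl, rfl, rfl, rfl⟩
    rfl
  have hZ : ∑ x, g x = 3 := by
    rw [sum_assign]
    simp only [hg, hinj, Fin.sum_univ_two]
    norm_num
  refine ⟨normalizedMarginals g, (mem_singleNode_iff _).2 ⟨g, hg0, by norm_num [hZ], rfl⟩, ?_⟩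
  rw [Set.mem_union, not_or]
  constructor
  · apply notMem_fourCycle <;>
    simp only [chshSum, normalizedMarginals_pair_e12, normalizedMarginals_pair_e14,
      normalizedMarginals_pair_e32, normalizedMarginals_pair_e34, hZ, Fin.sum_univ_two] <;>
    norm_num [hg, hinj]
  · intro hQ
    have := pair_e14_of_pair_e12_eq_zero hQ
    simp only [normalizedMarginals_pair_e12, normalizedMarginals_pair_e14, hZ, Fin.sum_univ_two]
      at this
    norm_num [hg, hinj] at this

/-- A violation of the CHSH inequality: the correlations `±2 / 3` lie between the classical bound
`1 / 2` and Tsirelson's bound `√2 / 2`. -/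
theorem nonempty_quantumMarginals_diff_singleNode :
    (quantumMarginals \ singleNode.realizableMarginals).Nonempty := by
  refine ⟨_, corrBeliefs_mem_quantumMarginals
    (posSemidef_pauliState_chsh (α := 2 / 3) (by norm_num) (by norm_num)), fun h => ?_⟩
  have := one_le_chshSum h
  norm_num [chshSum, corrBeliefs, sgn] at this

/-- Locally consistent marginals with `x₁ = x₂ = x₃`, a channel from `x₁` to `x₄` which is not
doubly stochastic, and a joint distribution of `x₃`, `x₄` with too small a probability of
`x₃ = x₄`. -/
theorem nonempty_localMarginalPolytope_diff :
    (localMarginalPolytope \ (singleNode.realizableMarginals ∪ quantumMarginals)).Nonempty := by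
  obtain ⟨β, hβ⟩ : ∃ β : Beliefs, β =
    { pair := onPairs !![1 / 2, 0; 0, 1 / 2] !![1 / 2, 0; 1 / 4, 1 / 4] !![1 / 2, 0; 0, 1 / 2]
        !![1 / 4, 1 / 4; 1 / 2, 0]
      single := assign ![1 / 2, 1 / 2] ![1 / 2, 1 / 2] ![1 / 2, 1 / 2] ![3 / 4, 1 / 4] } := ⟨_, rfl⟩
  refine ⟨β, mem_localMarginalPolytope_of_nonneg ?_ ?_ ?_ ?_, ?_⟩
  · simp only [forall_K, Fin.forall_fin_two]
    norm_num [hβ]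
  · simp only [forall_K, Fin.forall_fin_two, Fin.sum_univ_two]
    norm_num [hβ]
  · simp only [forall_K, Fin.forall_fin_two, Fin.sum_univ_two]
    norm_num [hβ]
  · intro i
    cases i <;> norm_num [hβ]
  rw [Set.mem_union, not_or]
  constructor
  · intro h
    have := one_le_chshSum h
    norm_num [chshSum, hβ] at this
  · intro hQ
    have := pair_e14_of_pair_e12_eq_zero hQ
    norm_num [hβ] at this

end TwoQubitMarginals

theorem mainTheorem3 :
    -- the inclusions of the diagram, all of them strict
    markovChain.realizableMarginals ⊂ fourCycle.realizableMarginals ∧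
    fourCycle.realizableMarginals ⊂ singleNode.realizableMarginals ∧
    singleNode.realizableMarginals ⊂ localMarginalPolytope ∧
    quantumMarginals ⊂ localMarginalPolytope ∧
    -- each of the eight regions of the diagram is non-empty
    (markovChain.realizableMarginals ∩ quantumMarginals).Nonempty ∧
    (markovChain.realizableMarginals \ quantumMarginals).Nonempty ∧
    ((fourCycle.realizableMarginals ∩ quantumMarginals) \
      markovChain.realizableMarginals).Nonempty ∧
    (fourCycle.realizableMarginals \
      (markovChain.realizableMarginals ∪ quantumMarginals)).Nonempty ∧
    ((singleNode.realizableMarginals ∩ quantumMarginals) \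
      fourCycle.realizableMarginals).Nonempty ∧
    (singleNode.realizableMarginals \
      (fourCycle.realizableMarginals ∪ quantumMarginals)).Nonempty ∧
    (quantumMarginals \ singleNode.realizableMarginals).Nonempty ∧
    (localMarginalPolytope \
      (singleNode.realizableMarginals ∪ quantumMarginals)).Nonempty := by
  have strict {s t : Set Beliefs} (h : s ⊆ t) (h' : (t \ s).Nonempty) : s ⊂ t :=
    h.ssubset_of_mem_notMem h'.some_mem.1 h'.some_mem.2
  have left {s t u : Set Beliefs} (h : (s \ (t ∪ u)).Nonempty) : (s \ t).Nonempty :=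
    h.mono (Set.sdiff_subset_sdiff_right Set.subset_union_left)
  have right {s t u : Set Beliefs} (h : (s \ (t ∪ u)).Nonempty) : (s \ u).Nonempty :=
    h.mono (Set.sdiff_subset_sdiff_right Set.subset_union_right)
  exact ⟨strict markovChain_subset_fourCycle (left nonempty_fourCycle_diff),
    strict fourCycle_subset_singleNode (left nonempty_singleNode_diff),
    strict singleNode_subset_localMarginalPolytope (left nonempty_localMarginalPolytope_diff),
    strict quantumMarginals_subset_localMarginalPolytope
      (right nonempty_localMarginalPolytope_diff),
    nonempty_markovChain_inter_quantumMarginals,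
    nonempty_markovChain_diff_quantumMarginals,
    nonempty_fourCycle_inter_quantumMarginals_diff_markovChain,
    nonempty_fourCycle_diff,
    nonempty_singleNode_inter_quantumMarginals_diff_fourCycle,
    nonempty_singleNode_diff,
    nonempty_quantumMarginals_diff_singleNode,
    nonempty_localMarginalPolytope_diff⟩
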